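/- **The smallest singular value of activation matrices.** Let $x_1,\dots,x_n\in\mathbb R^d$ be unit vectors, $X=(x_1,\dots,x_n)$, and let $\varphi'(z)=1$ for $z\ge 0$, $\varphi'(z)=0$ for $z<0$ (the derivative of ReLU). For $W=(w_1,\dots,w_m)\in\mathbb R^{d\times m}$ the activation matrix is $\Psi(W)=\varphi'(X^\top W)\in\{0,1\}^{n\times m}$ (entrywise). Put $$\mho=\mathbb E_{w\sim\mathcal N(0,I_d)}\big[\varphi'(X^\top w)\,\varphi'(w^\top X)\big],\qquad \lambda^*=\lambda_{\min}(\mho),$$ $$\theta^*=\min\Big\{\min_{i\ne j}\angle(x_i,x_j),\ \pi-\max_{i\ne j}\angle(x_i,x_j)\Big\},\qquad R=\sqrt{\frac{\pi\lambda^*\sin\theta^*}{(2+\varepsilon)n}} .$$ Let the initial weights $w_1(0),\dots,w_m(0)$ be independent with law $\mathcal N(0,I_d)$. For a sequence of weight matrices $W(0),W(1),W(2),\dots$ with this initial value write $\Psi(k)=\Psi(W(k))$. There is a universal constant $C>0$ such that for all $\varepsilon>0$, $\hbar>0$, $\varpi>4\hbar$, $c_0>0$, $c_1>0$ there are sequences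 $o_1(n)\to0$, $o_2(n)\to 0$ (depending only on $\varepsilon,\hbar,\varpi,c_0,c_1$) such that the following holds for all sufficiently large $n$, all $d$, all $m\ge n$, all $\delta\in(0,1)$ and all unit vectors $x_1,\dots,x_n\in\mathbb R^d$ with $$\lambda_{\min}(X^\top X)\ge c_0\log^{-2\hbar}n,\qquad m\ge c_1\,n^2\log^{1+\varpi}(n/\delta).$$ There is an event of probability exceeding $1-(mn-m+4n)\delta$ over the random initialization on which, for every sequence of weights $W(1),W(2),\dots$ (in particular for the iterates of gradient descent) and every $k\ge1$ with $\|w_r(k)-w_r(0)\|_2\le R$ for all $r=1,\dots,m$, $$\sigma_{\min}^2(\Psi(k))>\Big(1-\sqrt{\tfrac{2}{2+\varepsilon}}\Big)^2\lambda^*m+\Big(\sqrt{\tfrac{\pi}{2+\varepsilon}}-\sqrt{\tfrac1{2\pi}}+o_1(n)\Big)m\sqrt{\frac{\lambda^*\sin\theta^*}{n}}-C\Big(n\sqrt{m\log(2n/\delta)}+\frac{n\log(2n/\delta)}{\sqrt\delta}\Big),$$ and moreover $$\sigma_{\min}^2(\Psi(k))\ \ge\ \Big(\Big(1-\sqrt{\tfrac{2}{2+\varepsilon}}\Big)^2+o_2(n)\Big)\lambda^*m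 ,$$ so the smallest singular value squared of the activation matrix is bounded below at order $\lambda^* m$ as long as the weights stay within $R$ of their initial values. -/

import Mathlib

open Real Filter Topology MeasureTheory ProbabilityTheory
open scoped RealInnerProductSpace

noncomputable section

namespace TwoLayerReLU

/-- The smallest eigenvalue of a (real symmetric) matrix. -/
def minEigenvalue {n : ℕ} (A : Matrix (Fin n) (Fin n) ℝ) : ℝ :=
  sInf (spectrum ℝ A)

/-- The smallest singular value of a `p × q` matrix, i.e. its `min p q`-th largest one.
(Mathlib lists the singular values in decreasing order, starting with index `0`.) -/
def minSingularValue {p q : ℕ} (A : Matrix (Fin p) (Fin q) ℝ) : ℝ :=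
  (Matrix.toEuclideanLin A).singularValues (min p q - 1)

/-- The derivative of the ReLU function `z ↦ max z 0`, with the convention `φ' 0 = 1`. -/
def reluDeriv (z : ℝ) : ℝ := if 0 ≤ z then 1 else 0

/-- The activation matrix `Ψ = φ'(Xᵀ W)`, an `n × m` matrix of zeros and ones. The columns of the
data matrix `X` are the `x i`, the columns of the weight matrix `W` are the `w r`. -/
def activationMatrix {d n m : ℕ} (x : Fin n → EuclideanSpace ℝ (Fin d))
    (w : Fin m → EuclideanSpace ℝ (Fin d)) : Matrix (Fin n) (Fin m) ℝ :=
  Matrix.of fun i r => reluDeriv ⟪w r, x i⟫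

/-- The matrix `℧ = 𝔼[φ'(Xᵀ w) φ'(wᵀ X)]` for a standard Gaussian vector `w` of `ℝᵈ`. -/
def mho {d n : ℕ} (x : Fin n → EuclideanSpace ℝ (Fin d)) : Matrix (Fin n) (Fin n) ℝ :=
  Matrix.of fun i j =>
    ∫ w, reluDeriv ⟪w, x i⟫ * reluDeriv ⟪w, x j⟫ ∂(stdGaussian (EuclideanSpace ℝ (Fin d)))

/-- `λ* = λ_min(℧)`. -/
def lambdaStar {d n : ℕ} (x : Fin n → EuclideanSpace ℝ (Fin d)) : ℝ :=
  minEigenvalue (mho x)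

/-- The smallest angle between two data vectors with different indices. -/
def thetaMin {d n : ℕ} (x : Fin n → EuclideanSpace ℝ (Fin d)) : ℝ :=
  ⨅ p : {p : Fin n × Fin n // p.1 ≠ p.2}, InnerProductGeometry.angle (x p.1.1) (x p.1.2)

/-- The largest angle between two data vectors with different indices. -/
def thetaMax {d n : ℕ} (x : Fin n → EuclideanSpace ℝ (Fin d)) : ℝ :=
  ⨆ p : {p : Fin n × Fin n // p.1 ≠ p.2}, InnerProductGeometry.angle (x p.1.1) (x p.1.2)

/-- `θ* = min {θ_min, π - θ_max}`. -/
def thetaStar {d n : ℕ} (x : Fin n → EuclideanSpace ℝ (Fin d)) : ℝ :=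
  min (thetaMin x) (π - thetaMax x)

/-- The radius `R = √(π λ* sin θ* / ((2 + ε) n))`. -/
def radius {d n : ℕ} (ε : ℝ) (x : Fin n → EuclideanSpace ℝ (Fin d)) : ℝ :=
  √(π * lambdaStar x * sin (thetaStar x) / ((2 + ε) * n))

/-- The law of the initial weights: `w 1, …, w m` are independent standard Gaussian vectors. -/
def initLaw (d m : ℕ) : Measure (Fin m → EuclideanSpace ℝ (Fin d)) :=
  Measure.pi fun _ => stdGaussian (EuclideanSpace ℝ (Fin d))

end TwoLayerReLU

end

/-! Let D be the difference between the current activation matrix and the initial one. The smallest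
singular value is a minimum of ‖uᵀΨ‖ over unit u, so by the triangle inequality it is at least that
of the initial matrix minus the norm of D. Both quantities reduce to pair statistics of the initial
weights, which Hoeffding's inequality keeps within t = √(m log(2n/δ)) of their means
(`exists_concentration_event`). An entrywise error t costs nt in a quadratic form.

The initial matrix gives mλ* - nt. For D, an entry can be nonzero only if |⟨w, x_i⟩| ≤ R, and its
sign is determined by the initial sign of ⟨w, x_i⟩. Splitting u into positive and negative parts
(`sq_sum_mul_le`) therefore separates pairs of equal sign in the strip from pairs of opposite sign.
Each class covers half of the square |z|, |z'| ≤ R, so for i ≠ j it has probability at most R²/(π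
sin θ_ij) ≤ λ*/((2+ε)n) (`measureReal_box_mul_sin_le`). Counting the whole square would give twice
that. Together with the diagonal, ‖D‖² ≤ mλ*/(2+ε) + mR√(2/π) + nt.

The last two terms are o(mλ*): λ* ≥ κ² λ_min(XᵀX), with κ the mean of the positive part of a
standard Gaussian, makes nλ* tend to infinity, and the width condition with ϖ > 4ℏ handles nt. The
leading coefficient is thus (1 - √(1/(2+ε)))², strictly larger than (1 - √(2/(2+ε)))². This surplus
absorbs every correction, so both o(1) sequences can be zero (`exists_gap`). -/

namespace TwoLayerReLU

/-! ### Extremal singular values and eigenvalues through quadratic forms -/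

open Module in
/-- If `T*` is bounded below by `√c`, then the first `dim F` singular values of `T : E → F` are at
least `√c`. -/
theorem le_sq_singularValues {E F : Type*} [NormedAddCommGroup E] [InnerProductSpace ℝ E]
    [FiniteDimensional ℝ E] [NormedAddCommGroup F] [InnerProductSpace ℝ F] [FiniteDimensional ℝ F]
    (T : E →ₗ[ℝ] F) {c : ℝ} (h : ∀ u : F, c * ‖u‖ ^ 2 ≤ ‖LinearMap.adjoint T u‖ ^ 2) {i : ℕ}
    (hi : i < finrank ℝ F) : c ≤ T.singularValues i ^ 2 := by
  rcases le_or_gt c 0 with hc | hc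
  · exact hc.trans (sq_nonneg _)
  have hinj : Function.Injective (LinearMap.adjoint T) := by
    rw [injective_iff_map_eq_zero]
    intro u hu
    have := h u
    rw [hu, norm_zero] at this
    by_contra hne
    have : 0 < ‖u‖ ^ 2 := by positivity
    nlinarith
  have hi' : i < finrank ℝ E := hi.trans_le (LinearMap.finrank_le_finrank_of_injective hinj)
  set b := T.isSymmetric_adjoint_comp_self.eigenvectorBasis rfl with hb
  let L : F →ₗ[ℝ] (Fin i → ℝ) := LinearMap.pi fun j =>
    (innerₛₗ ℝ (b ⟨j, j.2.trans hi'⟩)) ∘ₗ LinearMap.adjoint T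
  -- Only i linear conditions on a space of dimension larger than i: some u ≠ 0 has T*u orthogonal
  -- to the top i eigenvectors of T*T, where T contracts to its i-th singular value.
  have hker : LinearMap.ker L ≠ ⊥ := LinearMap.ker_ne_bot_of_finrank_lt (by simpa using hi)
  obtain ⟨u, hu, hu0⟩ := Submodule.exists_mem_ne_zero_of_ne_bot hker
  set v := LinearMap.adjoint T u with hv
  have hv0 : v ≠ 0 := fun h0 => hu0 (hinj (by rw [← hv, h0, map_zero]))
  have hort : ∀ j : Fin (finrank ℝ E), (j : ℕ) < i → ⟪b j, v⟫ = 0 := by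
    intro j hj
    have := congrFun (LinearMap.mem_ker.1 hu) ⟨j, hj⟩
    simpa [L] using this
  have hTv : ‖T v‖ ^ 2 ≤ T.singularValues i ^ 2 * ‖v‖ ^ 2 := by
    have h1 : ‖T v‖ ^ 2 = ⟪v, (LinearMap.adjoint T ∘ₗ T) v⟫ := by
      rw [LinearMap.comp_apply, LinearMap.adjoint_inner_right, real_inner_self_eq_norm_sq]
    rw [h1, ← b.sum_inner_mul_inner, ← real_inner_self_eq_norm_sq, ← b.sum_inner_mul_inner,
      Finset.mul_sum]
    refine Finset.sum_le_sum fun j _ => ?_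
    have h2 : ⟪b j, (LinearMap.adjoint T ∘ₗ T) v⟫ = T.singularValues j ^ 2 * ⟪b j, v⟫ := by
      rw [← T.isSymmetric_adjoint_comp_self (b j) v,
        T.isSymmetric_adjoint_comp_self.apply_eigenvectorBasis rfl j, T.sq_singularValues_fin rfl,
        real_inner_smul_left]
      rfl
    rw [h2, real_inner_comm (b j) v]
    rcases lt_or_ge (j : ℕ) i with hj | hj
    · simp [hort j hj]
    · have h3 : T.singularValues j ^ 2 ≤ T.singularValues i ^ 2 :=
        pow_le_pow_left₀ (T.singularValues_nonneg _) (T.singularValues_antitone hj) 2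
      nlinarith [mul_self_nonneg ⟪b j, v⟫]
  -- ‖T*u‖² = ⟨u, T T*u⟩, then Cauchy–Schwarz; this turns the upper bound on Tv into one on v = T*u.
  have hlow : ‖v‖ ^ 2 ≤ ‖T v‖ * ‖u‖ := by
    rw [← real_inner_self_eq_norm_sq]
    conv_lhs => rw [hv, LinearMap.adjoint_inner_right, ← hv]
    exact real_inner_le_norm _ _
  have hvp : 0 < ‖v‖ ^ 2 := by positivity
  have hup : 0 < ‖u‖ ^ 2 := by positivity
  have h4 : (‖v‖ ^ 2) ^ 2 ≤ ‖T v‖ ^ 2 * ‖u‖ ^ 2 := by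
    rw [← mul_pow]; exact pow_le_pow_left₀ hvp.le hlow 2
  have h5 : c * ‖u‖ ^ 2 * ‖v‖ ^ 2 ≤ T.singularValues i ^ 2 * ‖u‖ ^ 2 * ‖v‖ ^ 2 := by
    calc c * ‖u‖ ^ 2 * ‖v‖ ^ 2 ≤ ‖v‖ ^ 2 * ‖v‖ ^ 2 := by gcongr; exact h u
      _ = (‖v‖ ^ 2) ^ 2 := by ring
      _ ≤ ‖T v‖ ^ 2 * ‖u‖ ^ 2 := h4
      _ ≤ T.singularValues i ^ 2 * ‖v‖ ^ 2 * ‖u‖ ^ 2 := by gcongr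
      _ = _ := by ring
  exact le_of_mul_le_mul_right (le_of_mul_le_mul_right h5 hvp) hup

theorem le_sq_minSingularValue {p q : ℕ} (hp : 0 < p) (A : Matrix (Fin p) (Fin q) ℝ) (hpq : p ≤ q)
    {c : ℝ} (h : ∀ u : Fin p → ℝ, c * ∑ i, u i ^ 2 ≤ ∑ r, (∑ i, u i * A i r) ^ 2) :
    c ≤ minSingularValue A ^ 2 := by
  refine le_sq_singularValues _ (fun u => ?_) (by simp; omega)
  rw [← Matrix.toEuclideanLin_conjTranspose_eq_adjoint, EuclideanSpace.real_norm_sq_eq,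
    EuclideanSpace.real_norm_sq_eq]
  refine (h u).trans_eq (Finset.sum_congr rfl fun r _ => ?_)
  simp [Matrix.mulVec, dotProduct, mul_comm]

/-- Subtracting the smallest eigenvalue times the identity leaves a matrix with nonnegative
spectrum. The infimum is a true lower bound because the spectrum is finite. -/
theorem minEigenvalue_mul_le {n : ℕ} {A : Matrix (Fin n) (Fin n) ℝ} (hA : A.IsHermitian)
    (u : Fin n → ℝ) : minEigenvalue A * ∑ i, u i ^ 2 ≤ u ⬝ᵥ A.mulVec u := by
  have hB : (A - minEigenvalue A • (1 : Matrix (Fin n) (Fin n) ℝ)).IsHermitian :=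
    hA.sub (by simp [Matrix.IsHermitian])
  have hpos : (A - minEigenvalue A • (1 : Matrix (Fin n) (Fin n) ℝ)).PosSemidef := by
    rw [hB.posSemidef_iff_eigenvalues_nonneg]
    intro i
    have h1 := hB.eigenvalues_mem_spectrum_real i
    generalize hB.eigenvalues i = μ at h1 ⊢
    rw [← Algebra.algebraMap_eq_smul_one, ← spectrum.sub_singleton_eq] at h1
    obtain ⟨ν, hν, _, rfl, rfl⟩ := Set.mem_sub.1 h1
    have h2 : minEigenvalue A ≤ ν := by
      refine csInf_le ?_ hν
      rw [hA.spectrum_real_eq_range_eigenvalues]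
      exact (Set.finite_range _).bddBelow
    simpa using h2
  have := hpos.dotProduct_mulVec_nonneg u
  simp only [Matrix.sub_mulVec, Matrix.smul_mulVec, Matrix.one_mulVec, dotProduct_sub,
    dotProduct_smul, star_trivial] at this
  simp only [dotProduct, smul_eq_mul] at this ⊢
  simp only [sq]
  linarith

theorem le_minEigenvalue {n : ℕ} (hn : 0 < n) {A : Matrix (Fin n) (Fin n) ℝ} (hA : A.IsHermitian)
    {c : ℝ} (h : ∀ u : Fin n → ℝ, c * ∑ i, u i ^ 2 ≤ u ⬝ᵥ A.mulVec u) : c ≤ minEigenvalue A := by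
  rw [minEigenvalue, hA.spectrum_real_eq_range_eigenvalues]
  have : Nonempty (Fin n) := ⟨⟨0, hn⟩⟩
  refine le_csInf (Set.range_nonempty _) ?_
  rintro _ ⟨i, rfl⟩
  have h1 := h (hA.eigenvectorBasis i)
  rw [hA.mulVec_eigenvectorBasis, dotProduct_smul] at h1
  have h2 : ∑ j, (hA.eigenvectorBasis i) j ^ 2 = 1 := by
    rw [← EuclideanSpace.real_norm_sq_eq, hA.eigenvectorBasis.norm_eq_one]; norm_num
  have h3 : (hA.eigenvectorBasis i).ofLp ⬝ᵥ (hA.eigenvectorBasis i).ofLp = 1 := by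
    rw [← h2]; simp [dotProduct, sq]
  rw [h2, h3] at h1
  simpa using h1

/-! ### Gaussian marginals and probabilities of strips and boxes -/

variable {d n m : ℕ}

theorem hasGaussianLaw_inner_prod (x y : EuclideanSpace ℝ (Fin d)) :
    HasGaussianLaw (fun w => (⟪w, x⟫, ⟪w, y⟫)) (stdGaussian (EuclideanSpace ℝ (Fin d))) := by
  have h := (IsGaussian.hasGaussianLaw_id (μ := stdGaussian (EuclideanSpace ℝ (Fin d)))).map_fun
    ((innerSL ℝ x).prod (innerSL ℝ y))
  simpa [real_inner_comm] using h

theorem hasGaussianLaw_inner (x : EuclideanSpace ℝ (Fin d)) :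
    HasGaussianLaw (fun w => ⟪w, x⟫) (stdGaussian (EuclideanSpace ℝ (Fin d))) :=
  (hasGaussianLaw_inner_prod x x).fst

theorem integral_inner_stdGaussian (x : EuclideanSpace ℝ (Fin d)) :
    ∫ w, ⟪w, x⟫ ∂stdGaussian (EuclideanSpace ℝ (Fin d)) = 0 := by
  simpa [real_inner_comm] using integral_strongDual_stdGaussian (innerSL ℝ x)

theorem integral_inner_mul_inner_stdGaussian (x y : EuclideanSpace ℝ (Fin d)) :
    ∫ w, ⟪w, x⟫ * ⟪w, y⟫ ∂stdGaussian (EuclideanSpace ℝ (Fin d)) = ⟪x, y⟫ := by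
  have h := covarianceBilin_apply (μ := stdGaussian (EuclideanSpace ℝ (Fin d)))
    IsGaussian.memLp_two_id x y
  rw [covarianceBilin_stdGaussian] at h
  rw [innerSL_apply_apply] at h
  simpa [real_inner_comm] using h.symm

theorem map_inner_stdGaussian {x : EuclideanSpace ℝ (Fin d)} (hx : ‖x‖ = 1) :
    (stdGaussian (EuclideanSpace ℝ (Fin d))).map (fun w => ⟪w, x⟫) = gaussianReal 0 1 := by
  rw [(hasGaussianLaw_inner x).map_eq_gaussianReal, integral_inner_stdGaussian,
    variance_of_integral_eq_zero (by fun_prop) (integral_inner_stdGaussian x)]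
  simp only [sq]
  rw [integral_inner_mul_inner_stdGaussian, real_inner_self_eq_norm_sq, hx]
  simp

theorem indepFun_inner_stdGaussian {x y : EuclideanSpace ℝ (Fin d)} (hxy : ⟪x, y⟫ = 0) :
    IndepFun (fun w => ⟪w, x⟫) (fun w => ⟪w, y⟫) (stdGaussian (EuclideanSpace ℝ (Fin d))) := by
  refine (hasGaussianLaw_inner_prod x y).indepFun_of_covariance_eq_zero ?_
  rw [covariance, integral_inner_stdGaussian, integral_inner_stdGaussian]
  simp [integral_inner_mul_inner_stdGaussian, hxy]

theorem map_inner_prod_stdGaussian {x y : EuclideanSpace ℝ (Fin d)} (hx : ‖x‖ = 1) (hy : ‖y‖ = 1)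
    (hxy : ⟪x, y⟫ = 0) :
    (stdGaussian (EuclideanSpace ℝ (Fin d))).map (fun w => (⟪w, x⟫, ⟪w, y⟫)) =
      (gaussianReal 0 1).prod (gaussianReal 0 1) := by
  rw [(indepFun_inner_stdGaussian hxy).map_prod_eq_prod_map_map (by fun_prop) (by fun_prop),
    map_inner_stdGaussian hx, map_inner_stdGaussian hy]

theorem gaussianReal_Icc_le (a b : ℝ) :
    gaussianReal 0 1 (Set.Icc a b) ≤ ENNReal.ofReal ((b - a) / √(2 * π)) := by
  rw [gaussianReal_apply _ one_ne_zero]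
  calc ∫⁻ x in Set.Icc a b, gaussianPDF 0 1 x
      ≤ ∫⁻ _ in Set.Icc a b, ENNReal.ofReal ((√(2 * π))⁻¹) := by
        refine lintegral_mono fun x => ENNReal.ofReal_le_ofReal ?_
        rw [gaussianPDFReal]
        simp only [NNReal.coe_one, mul_one]
        refine mul_le_of_le_one_right (by positivity) (Real.exp_le_one_iff.2 ?_)
        have := sq_nonneg (x - 0)
        linarith
    _ = _ := by
        rw [setLIntegral_const, Real.volume_Icc, ← ENNReal.ofReal_mul (by positivity), div_eq_inv_mul]

theorem measureReal_strip_le {x : EuclideanSpace ℝ (Fin d)} (hx : ‖x‖ = 1) {R : ℝ} (hR : 0 ≤ R) :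
    (stdGaussian (EuclideanSpace ℝ (Fin d))).real {w | |⟪w, x⟫| ≤ R} ≤ R * √(2 / π) := by
  have h : {w : EuclideanSpace ℝ (Fin d) | |⟪w, x⟫| ≤ R} = (fun w => ⟪w, x⟫) ⁻¹' Set.Icc (-R) R := by
    ext w; simp [abs_le]
  rw [h, measureReal_def, ← Measure.map_apply (by fun_prop) measurableSet_Icc,
    map_inner_stdGaussian hx]
  refine ENNReal.toReal_le_of_le_ofReal (by positivity) ((gaussianReal_Icc_le _ _).trans_eq ?_)
  congr 1
  rw [sqrt_div' _ (by positivity), sqrt_mul' _ (by positivity)]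
  have h2 : √2 * √2 = 2 := Real.mul_self_sqrt (by norm_num)
  have : √π ≠ 0 := by positivity
  field_simp
  nlinarith

/-- A set of pairs of reals whose sections have length at most `R` and which lies in the strip
`|z| ≤ R` carries little mass of a pair of standard Gaussians with correlation `cos ∠(x, y)`. -/
theorem measureReal_box_mul_sin_le {x y : EuclideanSpace ℝ (Fin d)} (hx : ‖x‖ = 1) (hy : ‖y‖ = 1)
    {R : ℝ} (hR : 0 ≤ R) {S : Set (ℝ × ℝ)} (hS : MeasurableSet S) (c : ℝ → ℝ)
    (h1 : ∀ p ∈ S, |p.1| ≤ R) (h2 : ∀ p ∈ S, c p.1 ≤ p.2 ∧ p.2 ≤ c p.1 + R) :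
    (stdGaussian (EuclideanSpace ℝ (Fin d))).real {w | (⟪w, x⟫, ⟪w, y⟫) ∈ S} *
      Real.sin (InnerProductGeometry.angle x y) ≤ R ^ 2 / π := by
  set θ := InnerProductGeometry.angle x y with hθ
  have hcos : ⟪x, y⟫ = Real.cos θ := by
    rw [InnerProductGeometry.cos_angle, hx, hy]; simp
  -- For parallel vectors the left side vanishes; multiplying by the sine instead of dividing keeps
  -- this case in the statement.
  rcases (InnerProductGeometry.sin_angle_nonneg x y).eq_or_lt with hs | hs
  · rw [hθ, ← hs, mul_zero]; positivity
  rw [← hθ] at hs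
  -- Gram–Schmidt: x and z are orthonormal, so the two coordinates of w become independent standard
  -- Gaussians.
  set z := (Real.sin θ)⁻¹ • (y - Real.cos θ • x) with hz
  have hxz : ⟪x, z⟫ = 0 := by
    rw [hz, real_inner_smul_right, inner_sub_right, real_inner_smul_right,
      real_inner_self_eq_norm_sq, hx, hcos]
    ring
  have hzn : ‖z‖ = 1 := by
    have h : ‖y - Real.cos θ • x‖ ^ 2 = Real.sin θ ^ 2 := by
      rw [norm_sub_sq_real, norm_smul, hx, hy, real_inner_smul_right, real_inner_comm, hcos,
        Real.norm_eq_abs, mul_one, sq_abs, Real.sin_sq]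
      ring
    rw [hz, norm_smul, (pow_left_inj₀ (norm_nonneg _) hs.le two_ne_zero).1 h, norm_inv,
      Real.norm_of_nonneg hs.le, inv_mul_cancel₀ hs.ne']
  have hy' : ∀ w : EuclideanSpace ℝ (Fin d),
      ⟪w, y⟫ = Real.cos θ * ⟪w, x⟫ + Real.sin θ * ⟪w, z⟫ := by
    intro w
    rw [hz, real_inner_smul_right, inner_sub_right, real_inner_smul_right, ← mul_assoc,
      mul_inv_cancel₀ hs.ne']
    ring
  let g : ℝ × ℝ → ℝ × ℝ := fun p => (p.1, Real.cos θ * p.1 + Real.sin θ * p.2)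
  have hg : Measurable g := by fun_prop
  have hpre : {w : EuclideanSpace ℝ (Fin d) | (⟪w, x⟫, ⟪w, y⟫) ∈ S} =
      (fun w => (⟪w, x⟫, ⟪w, z⟫)) ⁻¹' (g ⁻¹' S) := by
    ext w; simp [g, hy']
  -- In the z-coordinate a section of length R is stretched to R / sin θ, and the Gaussian density
  -- is at most 1/√(2π).
  have hsec : ∀ a : ℝ, gaussianReal 0 1 (Prod.mk a ⁻¹' (g ⁻¹' S)) ≤
      (Set.Icc (-R) R).indicator
        (fun _ => ENNReal.ofReal (R / (Real.sin θ * √(2 * π)))) a := by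
    intro a
    by_cases ha : a ∈ Set.Icc (-R) R
    · rw [Set.indicator_of_mem ha]
      calc gaussianReal 0 1 (Prod.mk a ⁻¹' (g ⁻¹' S))
          ≤ gaussianReal 0 1 (Set.Icc ((c a - Real.cos θ * a) / Real.sin θ)
              ((c a + R - Real.cos θ * a) / Real.sin θ)) := by
            refine measure_mono fun b hb => ?_
            have := h2 _ hb
            simp only [g] at this
            rw [Set.mem_Icc, div_le_iff₀ hs, le_div_iff₀ hs]
            constructor <;> linarith
        _ ≤ _ := gaussianReal_Icc_le _ _
        _ = _ := by
            congr 1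
            have : √(2 * π) ≠ 0 := by positivity
            field_simp
            ring
    · rw [Set.indicator_of_notMem ha]
      refine (measure_mono_null (t := ∅) (fun b hb => ha ?_) measure_empty).le
      simpa [abs_le] using h1 _ hb
  have hmeas : (stdGaussian (EuclideanSpace ℝ (Fin d))) {w | (⟪w, x⟫, ⟪w, y⟫) ∈ S} ≤
      ENNReal.ofReal (R / (Real.sin θ * √(2 * π)) * ((R - -R) / √(2 * π))) := by
    rw [hpre, ← Measure.map_apply (by fun_prop) (hg hS), map_inner_prod_stdGaussian hx hzn hxz,
      Measure.prod_apply (hg hS)]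
    refine (lintegral_mono hsec).trans ?_
    rw [lintegral_indicator measurableSet_Icc, setLIntegral_const,
      ENNReal.ofReal_mul (by positivity)]
    gcongr
    exact gaussianReal_Icc_le _ _
  have hreal := ENNReal.toReal_le_of_le_ofReal
    (by rw [sub_neg_eq_add]; positivity) hmeas
  rw [← measureReal_def] at hreal
  refine (mul_le_mul_of_nonneg_right hreal hs.le).trans_eq ?_
  have h3 : √(2 * π) * √(2 * π) = 2 * π := Real.mul_self_sqrt (by positivity)
  have : √(2 * π) ≠ 0 := by positivity
  field_simp
  rw [sq √(2 * π), h3]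
  ring

/-! ### Lower bound for λ* by the Gram matrix -/

theorem measurable_reluDeriv : Measurable reluDeriv :=
  Measurable.ite measurableSet_Ici measurable_const measurable_const

theorem reluDeriv_mem_Icc (z : ℝ) : reluDeriv z ∈ Set.Icc (0 : ℝ) 1 := by
  unfold reluDeriv; split_ifs <;> simp

theorem integrable_reluDeriv_mul_inner (x y : EuclideanSpace ℝ (Fin d)) :
    Integrable (fun w => reluDeriv ⟪w, x⟫ * ⟪w, y⟫)
      (stdGaussian (EuclideanSpace ℝ (Fin d))) := by
  refine (hasGaussianLaw_inner y).integrable.bdd_mul (c := 1)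
    ((measurable_reluDeriv.comp (by fun_prop)).aestronglyMeasurable) (ae_of_all _ fun w => ?_)
  rw [Real.norm_of_nonneg (reluDeriv_mem_Icc _).1]
  exact (reluDeriv_mem_Icc _).2

/-- The mean of the positive part of a standard Gaussian. -/
noncomputable def meanPosPart : ℝ := ∫ z, reluDeriv z * z ∂gaussianReal 0 1

theorem meanPosPart_pos : 0 < meanPosPart := by
  have hint : Integrable (fun z => reluDeriv z * z) (gaussianReal 0 1) := by
    refine (IsGaussian.integrable_id (μ := gaussianReal 0 1)).bdd_mul (c := 1)
      measurable_reluDeriv.aestronglyMeasurable (ae_of_all _ fun w => ?_)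
    rw [Real.norm_of_nonneg (reluDeriv_mem_Icc _).1]
    exact (reluDeriv_mem_Icc _).2
  have hnn : ∀ z, 0 ≤ reluDeriv z * z := by
    intro z; unfold reluDeriv; split_ifs with h <;> simp [h]
  rw [meanPosPart, integral_pos_iff_support_of_nonneg hnn hint]
  have hsub : Set.Ioi (0 : ℝ) ⊆ Function.support fun z => reluDeriv z * z := by
    intro z hz
    have hz' : (0 : ℝ) < z := hz
    simp [reluDeriv, hz'.le, hz'.ne']
  refine pos_iff_ne_zero.2 fun h0 => ?_
  have := gaussianReal_absolutelyContinuous' 0 one_ne_zero (measure_mono_null hsub h0)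
  simp at this

/-- The component of y orthogonal to x gives a centred variable independent of ⟨w, x⟩, so only the
component along x contributes. -/
theorem integral_reluDeriv_mul_inner {x : EuclideanSpace ℝ (Fin d)} (hx : ‖x‖ = 1)
    (y : EuclideanSpace ℝ (Fin d)) :
    ∫ w, reluDeriv ⟪w, x⟫ * ⟪w, y⟫ ∂stdGaussian (EuclideanSpace ℝ (Fin d)) =
      meanPosPart * ⟪x, y⟫ := by
  set z := y - ⟪x, y⟫ • x with hz
  have hxz : ⟪x, z⟫ = 0 := by
    rw [hz, inner_sub_right, real_inner_smul_right, real_inner_self_eq_norm_sq, hx]; ring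
  have hsplit : ∀ w : EuclideanSpace ℝ (Fin d), reluDeriv ⟪w, x⟫ * ⟪w, y⟫ =
      ⟪x, y⟫ * (reluDeriv ⟪w, x⟫ * ⟪w, x⟫) + reluDeriv ⟪w, x⟫ * ⟪w, z⟫ := by
    intro w
    rw [hz, inner_sub_right, real_inner_smul_right]; ring
  have hind : ∫ w, reluDeriv ⟪w, x⟫ * ⟪w, z⟫ ∂stdGaussian (EuclideanSpace ℝ (Fin d)) = 0 := by
    have h := (indepFun_inner_stdGaussian hxz).integral_fun_comp_mul_comp (f := reluDeriv)
      (g := fun t => t) (by fun_prop) (by fun_prop) measurable_reluDeriv.aestronglyMeasurable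
      measurable_id.aestronglyMeasurable
    rw [h, integral_inner_stdGaussian, mul_zero]
  simp_rw [hsplit]
  rw [integral_add ((integrable_reluDeriv_mul_inner x x).const_mul _)
    (integrable_reluDeriv_mul_inner x z), hind, integral_const_mul, add_zero, meanPosPart,
    ← map_inner_stdGaussian hx, integral_map (f := fun z => reluDeriv z * z) (by fun_prop)
      (measurable_reluDeriv.mul measurable_id).aestronglyMeasurable, mul_comm]

theorem integrable_reluDeriv_mul_reluDeriv (x y : EuclideanSpace ℝ (Fin d)) :
    Integrable (fun w => reluDeriv ⟪w, x⟫ * reluDeriv ⟪w, y⟫)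
      (stdGaussian (EuclideanSpace ℝ (Fin d))) := by
  refine Integrable.of_mem_Icc 0 1 ?_ (ae_of_all _ fun w => ?_)
  · exact ((measurable_reluDeriv.comp (by fun_prop)).mul
      (measurable_reluDeriv.comp (by fun_prop))).aemeasurable
  · have h1 := reluDeriv_mem_Icc ⟪w, x⟫
    have h2 := reluDeriv_mem_Icc ⟪w, y⟫
    exact ⟨mul_nonneg h1.1 h2.1, mul_le_one₀ h1.2 h2.1 h2.2⟩

theorem isHermitian_mho (x : Fin n → EuclideanSpace ℝ (Fin d)) : (mho x).IsHermitian := by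
  ext i j
  simp [mho, mul_comm]

theorem dotProduct_mulVec_eq_sum {A : Matrix (Fin n) (Fin n) ℝ} (u : Fin n → ℝ) :
    u ⬝ᵥ A.mulVec u = ∑ i, ∑ j, u i * u j * A i j := by
  simp only [dotProduct, Matrix.mulVec, Finset.mul_sum]
  exact Finset.sum_congr rfl fun i _ => Finset.sum_congr rfl fun j _ => by ring

/-- `λ* ≥ κ² λ_min(Xᵀ X)`, where `κ` is the mean of the positive part of a standard Gaussian. -/
theorem meanPosPart_sq_mul_minEigenvalue_gram_le_lambdaStar (hn : 0 < n)
    {x : Fin n → EuclideanSpace ℝ (Fin d)} (hx : ∀ i, ‖x i‖ = 1) :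
    meanPosPart ^ 2 * minEigenvalue (Matrix.gram ℝ x) ≤ lambdaStar x := by
  refine le_minEigenvalue hn (isHermitian_mho x) fun u => ?_
  set γ := stdGaussian (EuclideanSpace ℝ (Fin d))
  set y := ∑ i, u i • x i with hy
  have hgram : minEigenvalue (Matrix.gram ℝ x) * ∑ i, u i ^ 2 ≤ ⟪y, y⟫ := by
    refine (minEigenvalue_mul_le (Matrix.isHermitian_gram ℝ x) u).trans_eq ?_
    rw [dotProduct_mulVec_eq_sum, hy, sum_inner]
    refine Finset.sum_congr rfl fun i _ => ?_
    rw [inner_sum]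
    refine Finset.sum_congr rfl fun j _ => ?_
    rw [real_inner_smul_left, real_inner_smul_right, Matrix.gram_apply]
    ring
  -- Bessel's inequality in L²: approximate Σ u_i φ'(⟨w, x_i⟩) by the linear functional κ⟨w, y⟩.
  -- Expanding the square gives uᵀ℧u - 2κ²‖y‖² + κ²‖y‖².
  have hquad : 0 ≤ ∫ w, (∑ i, u i * reluDeriv ⟪w, x i⟫ - meanPosPart * ⟪w, y⟫) ^ 2 ∂γ :=
    integral_nonneg fun w => sq_nonneg _
  have hexp : ∀ w : EuclideanSpace ℝ (Fin d),
      (∑ i, u i * reluDeriv ⟪w, x i⟫ - meanPosPart * ⟪w, y⟫) ^ 2 =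
      ∑ i, ∑ j, u i * u j * (reluDeriv ⟪w, x i⟫ * reluDeriv ⟪w, x j⟫)
        - ∑ i, 2 * meanPosPart * u i * (reluDeriv ⟪w, x i⟫ * ⟪w, y⟫)
        + meanPosPart ^ 2 * (⟪w, y⟫ * ⟪w, y⟫) := by
    intro w
    have e1 : ∑ i, ∑ j, u i * u j * (reluDeriv ⟪w, x i⟫ * reluDeriv ⟪w, x j⟫) =
        (∑ i, u i * reluDeriv ⟪w, x i⟫) ^ 2 := by
      rw [sq, Finset.sum_mul_sum]
      exact Finset.sum_congr rfl fun i _ => Finset.sum_congr rfl fun j _ => by ring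
    have e2 : ∑ i, 2 * meanPosPart * u i * (reluDeriv ⟪w, x i⟫ * ⟪w, y⟫) =
        2 * meanPosPart * ⟪w, y⟫ * ∑ i, u i * reluDeriv ⟪w, x i⟫ := by
      rw [Finset.mul_sum]
      exact Finset.sum_congr rfl fun i _ => by ring
    rw [e1, e2]; ring
  have i1 : ∀ i, Integrable (fun w => ∑ j, u i * u j *
      (reluDeriv ⟪w, x i⟫ * reluDeriv ⟪w, x j⟫)) γ := fun i =>
    integrable_finsetSum _ fun j _ => (integrable_reluDeriv_mul_reluDeriv _ _).const_mul _
  have i2 : ∀ i, Integrable (fun w => 2 * meanPosPart * u i *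
      (reluDeriv ⟪w, x i⟫ * ⟪w, y⟫)) γ := fun i =>
    (integrable_reluDeriv_mul_inner _ _).const_mul _
  have i3 : Integrable (fun w => meanPosPart ^ 2 * (⟪w, y⟫ * ⟪w, y⟫)) γ :=
    ((hasGaussianLaw_inner y).memLp_two.integrable_mul
      (hasGaussianLaw_inner y).memLp_two).const_mul _
  simp_rw [hexp] at hquad
  have i4 := integrable_finsetSum Finset.univ fun i _ => i1 i
  have i5 := integrable_finsetSum Finset.univ fun i _ => i2 i
  have i6 : Integrable (fun w =>
      ∑ i, ∑ j, u i * u j * (reluDeriv ⟪w, x i⟫ * reluDeriv ⟪w, x j⟫)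
        - ∑ i, 2 * meanPosPart * u i * (reluDeriv ⟪w, x i⟫ * ⟪w, y⟫)) γ := i4.sub i5
  rw [integral_add i6 i3, integral_sub i4 i5,
    integral_finsetSum _ (fun i _ => i1 i), integral_finsetSum _ (fun i _ => i2 i),
    integral_const_mul, integral_inner_mul_inner_stdGaussian] at hquad
  have e4 : ∀ i, ∫ w, ∑ j, u i * u j * (reluDeriv ⟪w, x i⟫ * reluDeriv ⟪w, x j⟫) ∂γ =
      ∑ j, u i * u j * mho x i j := by
    intro i
    rw [integral_finsetSum _ fun j _ => (integrable_reluDeriv_mul_reluDeriv _ _).const_mul _]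
    exact Finset.sum_congr rfl fun j _ => integral_const_mul _ _
  have e5 : ∀ i, ∫ w, 2 * meanPosPart * u i * (reluDeriv ⟪w, x i⟫ * ⟪w, y⟫) ∂γ =
      2 * meanPosPart * u i * (meanPosPart * ⟪x i, y⟫) := by
    intro i
    rw [integral_const_mul, integral_reluDeriv_mul_inner (hx i)]
  simp_rw [e4, e5] at hquad
  have e3 : ∑ i, 2 * meanPosPart * u i * (meanPosPart * ⟪x i, y⟫) =
      2 * meanPosPart ^ 2 * ⟪y, y⟫ := by
    conv_rhs => rw [hy, sum_inner, ← hy, Finset.mul_sum]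
    refine Finset.sum_congr rfl fun i _ => ?_
    rw [real_inner_smul_left]; ring
  rw [e3] at hquad
  rw [dotProduct_mulVec_eq_sum]
  nlinarith [mul_le_mul_of_nonneg_left hgram (sq_nonneg meanPosPart)]

/-! ### Concentration of sums -/

/-- Hoeffding's inequality for finitely many functions of independent, identically distributed
variables. -/
theorem one_sub_le_measureReal_forall_sum_lt {Ω K : Type*} [MeasurableSpace Ω] [Fintype K]
    (γ : Measure Ω) [IsProbabilityMeasure γ] (f : K → Ω → ℝ) (hf : ∀ k, Measurable (f k))
    (a : K → ℝ) (hb : ∀ k w, f k w ∈ Set.Icc (a k) (a k + 1)) {t : ℝ} (ht : 0 ≤ t) :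
    MeasurableSet {w : Fin m → Ω | ∀ k, ∑ r, f k (w r) < m * ∫ v, f k v ∂γ + t} ∧
    1 - Fintype.card K * Real.exp (-2 * t ^ 2 / m) ≤
      (Measure.pi fun _ : Fin m => γ).real
        {w | ∀ k, ∑ r, f k (w r) < m * ∫ v, f k v ∂γ + t} := by
  set μ := Measure.pi fun _ : Fin m => γ
  have hmeas : MeasurableSet {w : Fin m → Ω | ∀ k, ∑ r, f k (w r) < m * ∫ v, f k v ∂γ + t} := by
    rw [Set.ofPred_forall]
    exact MeasurableSet.iInter fun k => measurableSet_lt (by fun_prop) measurable_const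
  refine ⟨hmeas, ?_⟩
  have hbad : ∀ k, μ.real {w | t ≤ ∑ r, (f k (w r) - ∫ v, f k v ∂γ)} ≤
      Real.exp (-2 * t ^ 2 / m) := by
    intro k
    have hind : iIndepFun (fun (r : Fin m) (w : Fin m → Ω) => f k (w r) - ∫ v, f k v ∂γ) μ :=
      iIndepFun_pi (X := fun (_ : Fin m) v => f k v - ∫ v, f k v ∂γ)
        fun _ => ((hf k).sub_const _).aemeasurable
    have hsub : ∀ r ∈ (Finset.univ : Finset (Fin m)), HasSubgaussianMGF
        (fun w : Fin m → Ω => f k (w r) - ∫ v, f k v ∂γ) ((‖a k + 1 - a k‖₊ / 2) ^ 2) μ := by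
      intro r _
      have h := hasSubgaussianMGF_of_mem_Icc (μ := γ) (hf k).aemeasurable (ae_of_all _ (hb k))
      rw [← (measurePreserving_eval (fun _ : Fin m => γ) r).map_eq] at h
      have h' := HasSubgaussianMGF.of_map (Y := fun w : Fin m → Ω => w r)
        (measurable_pi_apply r).aemeasurable h
      rw [(measurePreserving_eval (fun _ : Fin m => γ) r).map_eq] at h'
      exact h'
    refine (HasSubgaussianMGF.measure_sum_ge_le_of_iIndepFun hind hsub ht).trans_eq ?_
    congr 1
    simp
    rcases eq_or_ne (m : ℝ) 0 with h0 | h0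
    · simp [h0]
    · field_simp
  have hcompl : {w : Fin m → Ω | ∀ k, ∑ r, f k (w r) < m * ∫ v, f k v ∂γ + t}ᶜ =
      ⋃ k, {w | t ≤ ∑ r, (f k (w r) - ∫ v, f k v ∂γ)} := by
    ext w
    simp only [Set.mem_compl_iff, Set.mem_ofPred_eq, not_forall, not_lt, Set.mem_iUnion,
      Finset.sum_sub_distrib, Finset.sum_const, Finset.card_univ, Fintype.card_fin, nsmul_eq_mul]
    exact exists_congr fun k => by constructor <;> intro h <;> linarith
  have hunion : μ.real (⋃ k, {w | t ≤ ∑ r, (f k (w r) - ∫ v, f k v ∂γ)}) ≤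
      Fintype.card K * Real.exp (-2 * t ^ 2 / m) := by
    refine (measureReal_iUnion_fintype_le _).trans ((Finset.sum_le_sum fun k _ => hbad k).trans_eq ?_)
    simp
  have := probReal_add_probReal_compl (μ := μ) hmeas
  rw [hcompl] at this
  linarith

/-! ### Pairs of activations that can switch -/

/-- The indicator function of `[0, R]`. -/
noncomputable def posStrip (R z : ℝ) : ℝ := if 0 ≤ z ∧ z ≤ R then 1 else 0

/-- The indicator function of `[-R, 0)`. -/
noncomputable def negStrip (R z : ℝ) : ℝ := if -R ≤ z ∧ z < 0 then 1 else 0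

/-- The indicator function of the pairs in the strip of width `R` with equal signs. -/
noncomputable def sameSign (R z z' : ℝ) : ℝ :=
  posStrip R z * posStrip R z' + negStrip R z * negStrip R z'

/-- The indicator function of the pairs in the strip of width `R` with opposite signs. -/
noncomputable def oppSign (R z z' : ℝ) : ℝ :=
  posStrip R z * negStrip R z' + negStrip R z * posStrip R z'

theorem measurable_posStrip (R : ℝ) : Measurable (posStrip R) :=
  Measurable.ite (measurableSet_Icc (a := (0 : ℝ)) (b := R)) measurable_const measurable_const

theorem measurable_negStrip (R : ℝ) : Measurable (negStrip R) :=
  Measurable.ite (measurableSet_Ico (a := -R) (b := (0 : ℝ))) measurable_const measurable_const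

theorem sameSign_mem_Icc (R z z' : ℝ) : sameSign R z z' ∈ Set.Icc (0 : ℝ) 1 := by
  unfold sameSign posStrip negStrip
  grind

theorem oppSign_mem_Icc (R z z' : ℝ) : oppSign R z z' ∈ Set.Icc (0 : ℝ) 1 := by
  unfold oppSign posStrip negStrip
  grind

theorem measurable_sameSign (R : ℝ) : Measurable fun p : ℝ × ℝ => sameSign R p.1 p.2 :=
  (((measurable_posStrip R).comp measurable_fst).mul
    ((measurable_posStrip R).comp measurable_snd)).add
  (((measurable_negStrip R).comp measurable_fst).mul
    ((measurable_negStrip R).comp measurable_snd))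

theorem measurable_oppSign (R : ℝ) : Measurable fun p : ℝ × ℝ => oppSign R p.1 p.2 :=
  (((measurable_posStrip R).comp measurable_fst).mul
    ((measurable_negStrip R).comp measurable_snd)).add
  (((measurable_negStrip R).comp measurable_fst).mul
    ((measurable_posStrip R).comp measurable_snd))

theorem measurable_comp_inner_inner {f : ℝ → ℝ → ℝ} (hf : Measurable fun p : ℝ × ℝ => f p.1 p.2)
    (x y : EuclideanSpace ℝ (Fin d)) : Measurable fun w => f ⟪w, x⟫ ⟪w, y⟫ :=
  hf.comp (f := fun w : EuclideanSpace ℝ (Fin d) => (⟪w, x⟫, ⟪w, y⟫)) (by fun_prop)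

theorem integral_comp_inner_inner {f : ℝ → ℝ → ℝ} (hf : Measurable fun p : ℝ × ℝ => f p.1 p.2)
    (h01 : ∀ z z', f z z' = 0 ∨ f z z' = 1) (x y : EuclideanSpace ℝ (Fin d)) :
    ∫ w, f ⟪w, x⟫ ⟪w, y⟫ ∂stdGaussian (EuclideanSpace ℝ (Fin d)) =
      (stdGaussian (EuclideanSpace ℝ (Fin d))).real
        {w | (⟪w, x⟫, ⟪w, y⟫) ∈ {p : ℝ × ℝ | f p.1 p.2 = 1}} := by
  have hm : MeasurableSet {w : EuclideanSpace ℝ (Fin d) |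
      (⟪w, x⟫, ⟪w, y⟫) ∈ {p : ℝ × ℝ | f p.1 p.2 = 1}} :=
    measurable_comp_inner_inner hf x y (measurableSet_singleton 1)
  rw [← integral_indicator_one hm]
  congr 1
  ext w
  rcases h01 ⟪w, x⟫ ⟪w, y⟫ with h | h <;> simp [Set.indicator, h]

theorem integral_mul_sin_le_of_section {f : ℝ → ℝ → ℝ}
    (hf : Measurable fun p : ℝ × ℝ => f p.1 p.2) (h01 : ∀ z z', f z z' = 0 ∨ f z z' = 1)
    {R : ℝ} (hR : 0 ≤ R) (c : ℝ → ℝ)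
    (hc : ∀ z z', f z z' = 1 → |z| ≤ R ∧ c z ≤ z' ∧ z' ≤ c z + R)
    {x y : EuclideanSpace ℝ (Fin d)} (hx : ‖x‖ = 1) (hy : ‖y‖ = 1) :
    (∫ w, f ⟪w, x⟫ ⟪w, y⟫ ∂stdGaussian (EuclideanSpace ℝ (Fin d))) *
        Real.sin (InnerProductGeometry.angle x y) ≤ R ^ 2 / π ∧
    ∫ w, f ⟪w, x⟫ ⟪w, y⟫ ∂stdGaussian (EuclideanSpace ℝ (Fin d)) ≤ R * √(2 / π) := by
  rw [integral_comp_inner_inner hf h01]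
  refine ⟨measureReal_box_mul_sin_le hx hy hR (hf (measurableSet_singleton 1)) c
    (fun p hp => (hc _ _ hp).1) (fun p hp => (hc _ _ hp).2), ?_⟩
  exact (measureReal_mono fun w hw => (hc _ _ hw).1).trans (measureReal_strip_le hx hR)

/-- For fixed z the sign of z' is forced, so z' ranges over an interval of length R and not 2R; this
is the factor two behind the final surplus. -/
theorem sameSign_section {R : ℝ} (z z' : ℝ) (h : sameSign R z z' = 1) :
    |z| ≤ R ∧ (if 0 ≤ z then 0 else -R) ≤ z' ∧ z' ≤ (if 0 ≤ z then 0 else -R) + R := by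
  unfold sameSign posStrip negStrip at h
  rw [abs_le]
  grind

theorem oppSign_section {R : ℝ} (z z' : ℝ) (h : oppSign R z z' = 1) :
    |z| ≤ R ∧ (if 0 ≤ z then -R else 0) ≤ z' ∧ z' ≤ (if 0 ≤ z then -R else 0) + R := by
  unfold oppSign posStrip negStrip at h
  rw [abs_le]
  grind

theorem sameSign_eq_zero_or_one (R z z' : ℝ) : sameSign R z z' = 0 ∨ sameSign R z z' = 1 := by
  unfold sameSign posStrip negStrip
  grind

theorem oppSign_eq_zero_or_one (R z z' : ℝ) : oppSign R z z' = 0 ∨ oppSign R z z' = 1 := by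
  unfold oppSign posStrip negStrip
  grind

/-- A move of size at most R can only turn off an activation starting in [0, R], or turn on one
starting in [-R, 0). -/
theorem reluDeriv_sub_mem_Icc {R z z' : ℝ} (h : |z' - z| ≤ R) :
    reluDeriv z' - reluDeriv z ∈ Set.Icc (-posStrip R z) (negStrip R z) := by
  rw [abs_le] at h
  unfold reluDeriv posStrip negStrip
  rw [Set.mem_Icc]
  grind

/-- P is the maximum and -M the minimum of Σ u_i D_i over the box, so the square is at most max(P²,
M²) ≤ P² + M². In this sum every product of a's and b's joins the equal-sign or the opposite-sign
pairs. -/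
theorem sq_sum_mul_le {ι : Type*} [Fintype ι] (u D a b : ι → ℝ)
    (hD : ∀ i, D i ∈ Set.Icc (-a i) (b i)) :
    (∑ i, u i * D i) ^ 2 ≤ ∑ i, ∑ j,
      (((u i)⁺ * (u j)⁺ + (u i)⁻ * (u j)⁻) * (a i * a j + b i * b j) +
        ((u i)⁺ * (u j)⁻ + (u i)⁻ * (u j)⁺) * (a i * b j + b i * a j)) := by
  set P := ∑ i, ((u i)⁺ * b i + (u i)⁻ * a i) with hP
  set M := ∑ i, ((u i)⁺ * a i + (u i)⁻ * b i) with hM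
  have hPM : ∑ i, ∑ j,
      (((u i)⁺ * (u j)⁺ + (u i)⁻ * (u j)⁻) * (a i * a j + b i * b j) +
        ((u i)⁺ * (u j)⁻ + (u i)⁻ * (u j)⁺) * (a i * b j + b i * a j)) = P ^ 2 + M ^ 2 := by
    rw [sq, sq, hP, hM, Finset.sum_mul_sum, Finset.sum_mul_sum, ← Finset.sum_add_distrib]
    refine Finset.sum_congr rfl fun i _ => ?_
    rw [← Finset.sum_add_distrib]
    exact Finset.sum_congr rfl fun j _ => by ring
  have hp : ∀ i, 0 ≤ (u i)⁺ := fun i => posPart_nonneg _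
  have hq : ∀ i, 0 ≤ (u i)⁻ := fun i => negPart_nonneg _
  have hup : ∑ i, u i * D i ≤ P := by
    refine Finset.sum_le_sum fun i _ => ?_
    have h1 := mul_le_mul_of_nonneg_left (hD i).2 (hp i)
    have h2 := mul_le_mul_of_nonneg_left (hD i).1 (hq i)
    have h3 : u i * D i = (u i)⁺ * D i - (u i)⁻ * D i := by rw [← sub_mul, posPart_sub_negPart]
    linarith
  have hlo : -M ≤ ∑ i, u i * D i := by
    rw [hM, ← Finset.sum_neg_distrib]
    refine Finset.sum_le_sum fun i _ => ?_
    have h1 := mul_le_mul_of_nonneg_left (hD i).1 (hp i)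
    have h2 := mul_le_mul_of_nonneg_left (hD i).2 (hq i)
    have h3 : u i * D i = (u i)⁺ * D i - (u i)⁻ * D i := by rw [← sub_mul, posPart_sub_negPart]
    linarith
  rw [hPM]
  rcases le_total 0 (∑ i, u i * D i) with h | h
  · nlinarith [sq_nonneg M]
  · nlinarith [sq_nonneg P]

/-- The triangle inequality in ℝᵐ; D ≤ L makes the difference of roots nonnegative, so that it may
be squared. -/
theorem mul_sum_sq_le_sum_add_sq {L D U : ℝ} (hU : 0 ≤ U) (hD : 0 ≤ D) (hDL : D ≤ L)
    (a b : Fin m → ℝ) (ha : L * U ≤ ∑ r, a r ^ 2) (hb : ∑ r, b r ^ 2 ≤ D * U) :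
    (√L - √D) ^ 2 * U ≤ ∑ r, (a r + b r) ^ 2 := by
  set α : EuclideanSpace ℝ (Fin m) := WithLp.toLp 2 a
  set β : EuclideanSpace ℝ (Fin m) := WithLp.toLp 2 b
  have hα : √L * √U ≤ ‖α‖ := by
    rw [← Real.sqrt_mul (hD.trans hDL)]
    refine Real.sqrt_le_iff.2 ⟨norm_nonneg _, ?_⟩
    rw [EuclideanSpace.real_norm_sq_eq]; exact ha
  have hβ : ‖β‖ ≤ √D * √U := by
    rw [← Real.sqrt_mul hD]
    refine Real.le_sqrt_of_sq_le ?_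
    rw [EuclideanSpace.real_norm_sq_eq]; exact hb
  have h1 : ‖α‖ ≤ ‖α + β‖ + ‖β‖ := by
    simpa using norm_sub_le (α + β) β
  have h2 : (√L - √D) * √U ≤ ‖α + β‖ := by linarith
  have h3 : 0 ≤ (√L - √D) * √U :=
    mul_nonneg (sub_nonneg.2 (Real.sqrt_le_sqrt hDL)) (Real.sqrt_nonneg _)
  have h4 := pow_le_pow_left₀ h3 h2 2
  rw [mul_pow, Real.sq_sqrt hU, EuclideanSpace.real_norm_sq_eq] at h4
  exact h4

/-! ### The singular value bound on the concentration event -/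

/-- With high probability, the pair statistics of the random initialization are close to their
means. -/
theorem exists_concentration_event (x : Fin n → EuclideanSpace ℝ (Fin d)) (R : ℝ) {t : ℝ}
    (ht : 0 ≤ t) :
    ∃ E : Set (Fin m → EuclideanSpace ℝ (Fin d)), MeasurableSet E ∧
      1 - 4 * (n : ℝ) ^ 2 * Real.exp (-2 * t ^ 2 / m) ≤ (initLaw d m).real E ∧
      ∀ w ∈ E, ∀ i j,
        |∑ r, reluDeriv ⟪w r, x i⟫ * reluDeriv ⟪w r, x j⟫ - m * mho x i j| ≤ t ∧
        ∑ r, sameSign R ⟪w r, x i⟫ ⟪w r, x j⟫ ≤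
          m * ∫ v, sameSign R ⟪v, x i⟫ ⟪v, x j⟫ ∂stdGaussian (EuclideanSpace ℝ (Fin d)) + t ∧
        ∑ r, oppSign R ⟪w r, x i⟫ ⟪w r, x j⟫ ≤
          m * ∫ v, oppSign R ⟪v, x i⟫ ⟪v, x j⟫ ∂stdGaussian (EuclideanSpace ℝ (Fin d)) + t := by
  -- The activation product occurs with both signs to obtain a two-sided bound; with n² index pairs
  -- this makes 4n² one-sided events.
  let F : Fin 4 → ℝ → ℝ → ℝ := ![fun z z' => reluDeriv z * reluDeriv z',
    fun z z' => -(reluDeriv z * reluDeriv z'), sameSign R, oppSign R]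
  let f : (Fin n × Fin n) × Fin 4 → EuclideanSpace ℝ (Fin d) → ℝ := fun k w =>
    F k.2 ⟪w, x k.1.1⟫ ⟪w, x k.1.2⟫
  have hrelu : Measurable fun p : ℝ × ℝ => reluDeriv p.1 * reluDeriv p.2 :=
    (measurable_reluDeriv.comp measurable_fst).mul (measurable_reluDeriv.comp measurable_snd)
  have hF : ∀ k, Measurable fun p : ℝ × ℝ => F k p.1 p.2 := by
    intro k
    fin_cases k
    exacts [hrelu, hrelu.neg, measurable_sameSign R, measurable_oppSign R]
  have hrange : ∀ k z z', F k z z' ∈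
      Set.Icc ((![0, -1, 0, 0] : Fin 4 → ℝ) k) ((![0, -1, 0, 0] : Fin 4 → ℝ) k + 1) := by
    intro k z z'
    have h1 := reluDeriv_mem_Icc z
    have h2 := reluDeriv_mem_Icc z'
    have h3 := mul_nonneg h1.1 h2.1
    have h4 := mul_le_one₀ h1.2 h2.1 h2.2
    fin_cases k
    · simpa [F] using ⟨h3, h4⟩
    · simpa [F] using ⟨h4, h3⟩
    · simpa [F] using sameSign_mem_Icc R z z'
    · simpa [F] using oppSign_mem_Icc R z z'
  obtain ⟨hE, hP⟩ := one_sub_le_measureReal_forall_sum_lt (m := m)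
    (stdGaussian (EuclideanSpace ℝ (Fin d))) f
    (fun k => measurable_comp_inner_inner (hF k.2) _ _) (fun k => (![0, -1, 0, 0] : Fin 4 → ℝ) k.2)
    (fun k w => hrange _ _ _) ht
  refine ⟨_, hE, ?_, fun w hw i j => ⟨?_, ?_, ?_⟩⟩
  · refine le_trans (le_of_eq ?_) hP
    simp only [Fintype.card_prod, Fintype.card_fin]
    push_cast
    ring
  · have h0 := hw ((i, j), 0)
    have h1 := hw ((i, j), 1)
    simp only [f, F, Matrix.cons_val_zero, Matrix.cons_val_one, Finset.sum_neg_distrib,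
      integral_neg] at h0 h1
    rw [abs_le, mho, Matrix.of_apply]
    constructor <;> linarith
  · exact (hw ((i, j), 2)).le
  · exact (hw ((i, j), 3)).le

/-- Sine increases up to π/2 and is symmetric about it: compare θ* with θ_ij if that is acute, with
π - θ_ij otherwise. -/
theorem sin_thetaStar_mem_Icc (x : Fin n → EuclideanSpace ℝ (Fin d)) {i j : Fin n} (hij : i ≠ j) :
    Real.sin (thetaStar x) ∈
      Set.Icc 0 (Real.sin (InnerProductGeometry.angle (x i) (x j))) := by
  set θ := InnerProductGeometry.angle (x i) (x j) with hθ
  have : Nonempty {p : Fin n × Fin n // p.1 ≠ p.2} := ⟨⟨(i, j), hij⟩⟩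
  have h1 : thetaMin x ≤ θ := ciInf_le (Set.finite_range _).bddBelow
    (⟨(i, j), hij⟩ : {p : Fin n × Fin n // p.1 ≠ p.2})
  have h2 : θ ≤ thetaMax x := le_ciSup
    (f := fun p : {p : Fin n × Fin n // p.1 ≠ p.2} =>
      InnerProductGeometry.angle (x p.1.1) (x p.1.2)) (Set.finite_range _).bddAbove ⟨(i, j), hij⟩
  have h3 : 0 ≤ thetaMin x := le_ciInf fun p => InnerProductGeometry.angle_nonneg _ _
  have h4 : thetaMax x ≤ π := ciSup_le fun p => InnerProductGeometry.angle_le_pi _ _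
  have h5 : 0 ≤ thetaStar x := le_min h3 (by linarith)
  have h6 : thetaStar x ≤ θ := (min_le_left _ _).trans h1
  have h7 : thetaStar x ≤ π - θ := (min_le_right _ _).trans (by linarith)
  refine ⟨Real.sin_nonneg_of_nonneg_of_le_pi h5 (by linarith), ?_⟩
  rcases le_total θ (π / 2) with h | h
  · exact Real.sin_le_sin_of_le_of_le_pi_div_two (by linarith) h h6
  · rw [← Real.sin_pi_sub θ]
    exact Real.sin_le_sin_of_le_of_le_pi_div_two (by linarith) (by linarith) h7

/-- R² is proportional to sin θ* exactly so that this factor cancels against sin θ_ij off the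
diagonal. The diagonal has no angle to exploit and keeps the strip bound. -/
theorem le_add_ite_of_mul_sin_le {ε : ℝ} (hε : 0 < ε) (x : Fin n → EuclideanSpace ℝ (Fin d))
    (hl : 0 ≤ lambdaStar x) (i j : Fin n) {I : ℝ}
    (h1 : I * Real.sin (InnerProductGeometry.angle (x i) (x j)) ≤ radius ε x ^ 2 / π)
    (h2 : I ≤ radius ε x * √(2 / π)) :
    I ≤ lambdaStar x / ((2 + ε) * n) + if i = j then radius ε x * √(2 / π) else 0 := by
  have hb : 0 ≤ lambdaStar x / ((2 + ε) * n) := by positivity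
  split_ifs with hij
  · linarith
  rw [add_zero]
  obtain ⟨hs0, hs1⟩ := sin_thetaStar_mem_Icc x hij
  -- If sin θ_ij = 0 then sin θ* = 0, hence R = 0, and the strip bound already gives I ≤ 0.
  rcases (hs0.trans hs1).eq_or_lt with hs | hs
  · have h0 : Real.sin (thetaStar x) = 0 := le_antisymm (hs1.trans_eq hs.symm) hs0
    have hR : radius ε x = 0 := by simp [radius, h0]
    rw [hR, zero_mul] at h2
    exact h2.trans hb
  · refine le_of_mul_le_mul_right (h1.trans ?_) hs
    rw [radius, Real.sq_sqrt (by positivity)]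
    calc π * lambdaStar x * Real.sin (thetaStar x) / ((2 + ε) * n) / π
        = lambdaStar x / ((2 + ε) * n) * Real.sin (thetaStar x) := by
          have := Real.pi_ne_zero
          field_simp
      _ ≤ _ := by gcongr

theorem sq_sum_abs_le (u : Fin n → ℝ) : ∑ i, ∑ j, |u i| * |u j| ≤ n * ∑ i, u i ^ 2 := by
  rw [← Finset.sum_mul_sum, ← sq]
  simpa using sq_sum_le_card_mul_sum_sq (s := Finset.univ) (f := fun i => |u i|)

/-- The quadratic form of an error with entries at most t is at most t(Σ|u_i|)² ≤ nt Σ u_i². -/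
theorem le_sum_sq_of_abs_sub_mho_le {x : Fin n → EuclideanSpace ℝ (Fin d)} {t : ℝ} (ht : 0 ≤ t)
    {w : Fin m → EuclideanSpace ℝ (Fin d)}
    (h : ∀ i j, |∑ r, reluDeriv ⟪w r, x i⟫ * reluDeriv ⟪w r, x j⟫ - m * mho x i j| ≤ t)
    (u : Fin n → ℝ) :
    (m * lambdaStar x - n * t) * ∑ i, u i ^ 2 ≤ ∑ r, (∑ i, u i * reluDeriv ⟪w r, x i⟫) ^ 2 := by
  have e1 : ∑ r, (∑ i, u i * reluDeriv ⟪w r, x i⟫) ^ 2 =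
      ∑ i, ∑ j, u i * u j * ∑ r, reluDeriv ⟪w r, x i⟫ * reluDeriv ⟪w r, x j⟫ := by
    simp_rw [sq, Finset.sum_mul_sum, Finset.mul_sum]
    rw [Finset.sum_comm]
    refine Finset.sum_congr rfl fun i _ => ?_
    rw [Finset.sum_comm]
    exact Finset.sum_congr rfl fun j _ => Finset.sum_congr rfl fun r _ => by ring
  have e2 : m * ∑ i, ∑ j, u i * u j * mho x i j - t * ∑ i, ∑ j, |u i| * |u j| ≤
      ∑ i, ∑ j, u i * u j * ∑ r, reluDeriv ⟪w r, x i⟫ * reluDeriv ⟪w r, x j⟫ := by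
    simp_rw [Finset.mul_sum, ← Finset.sum_sub_distrib, ← Finset.mul_sum]
    refine Finset.sum_le_sum fun i _ => Finset.sum_le_sum fun j _ => ?_
    have h1 := mul_le_mul_of_nonneg_left (h i j) (abs_nonneg (u i * u j))
    rw [← abs_mul, abs_mul (u i)] at h1
    have h2 := (abs_le.1 h1).1
    linarith
  have e3 := minEigenvalue_mul_le (isHermitian_mho x) u
  rw [dotProduct_mulVec_eq_sum] at e3
  have e4 := mul_le_mul_of_nonneg_left (sq_sum_abs_le u) ht
  have e5 := mul_le_mul_of_nonneg_left e3 (Nat.cast_nonneg (α := ℝ) m)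
  rw [e1]
  rw [lambdaStar]
  linarith

theorem sum_sq_le_of_pair_counts_le {x : Fin n → EuclideanSpace ℝ (Fin d)} {R b s t : ℝ}
    {w w' : Fin m → EuclideanSpace ℝ (Fin d)} (hx : ∀ i, ‖x i‖ = 1)
    (hw : ∀ r, ‖w' r - w r‖ ≤ R)
    (h1 : ∀ i j, ∑ r, sameSign R ⟪w r, x i⟫ ⟪w r, x j⟫ ≤ (b + if i = j then s else 0) + t)
    (h2 : ∀ i j, ∑ r, oppSign R ⟪w r, x i⟫ ⟪w r, x j⟫ ≤ (b + if i = j then s else 0) + t)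
    (hbt : 0 ≤ b + t) (u : Fin n → ℝ) :
    ∑ r, (∑ i, u i * (reluDeriv ⟪w' r, x i⟫ - reluDeriv ⟪w r, x i⟫)) ^ 2 ≤
      (s + n * b + n * t) * ∑ i, u i ^ 2 := by
  have hΔ : ∀ r i, reluDeriv ⟪w' r, x i⟫ - reluDeriv ⟪w r, x i⟫ ∈
      Set.Icc (-posStrip R ⟪w r, x i⟫) (negStrip R ⟪w r, x i⟫) := by
    intro r i
    refine reluDeriv_sub_mem_Icc ?_
    rw [← inner_sub_left]
    calc |⟪w' r - w r, x i⟫| ≤ ‖w' r - w r‖ * ‖x i‖ := abs_real_inner_le_norm _ _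
      _ ≤ R := by rw [hx, mul_one]; exact hw r
  calc ∑ r, (∑ i, u i * (reluDeriv ⟪w' r, x i⟫ - reluDeriv ⟪w r, x i⟫)) ^ 2
      ≤ ∑ r, ∑ i, ∑ j,
        (((u i)⁺ * (u j)⁺ + (u i)⁻ * (u j)⁻) * sameSign R ⟪w r, x i⟫ ⟪w r, x j⟫ +
        ((u i)⁺ * (u j)⁻ + (u i)⁻ * (u j)⁺) * oppSign R ⟪w r, x i⟫ ⟪w r, x j⟫) :=
        Finset.sum_le_sum fun r _ => sq_sum_mul_le u _ _ _ (hΔ r)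
    _ = ∑ i, ∑ j,
        (((u i)⁺ * (u j)⁺ + (u i)⁻ * (u j)⁻) * ∑ r, sameSign R ⟪w r, x i⟫ ⟪w r, x j⟫ +
        ((u i)⁺ * (u j)⁻ + (u i)⁻ * (u j)⁺) * ∑ r, oppSign R ⟪w r, x i⟫ ⟪w r, x j⟫) := by
        rw [Finset.sum_comm]
        refine Finset.sum_congr rfl fun i _ => ?_
        rw [Finset.sum_comm]
        refine Finset.sum_congr rfl fun j _ => ?_
        rw [Finset.sum_add_distrib, Finset.mul_sum, Finset.mul_sum]
    _ ≤ ∑ i, ∑ j, ((b + t) * (|u i| * |u j|) + if i = j then s * u i ^ 2 else 0) := by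
        refine Finset.sum_le_sum fun i _ => Finset.sum_le_sum fun j _ => ?_
        have hp := fun i => posPart_nonneg (u i)
        have hq := fun i => negPart_nonneg (u i)
        have g1 := mul_le_mul_of_nonneg_left (h1 i j)
          (add_nonneg (mul_nonneg (hp i) (hp j)) (mul_nonneg (hq i) (hq j)))
        have g2 := mul_le_mul_of_nonneg_left (h2 i j)
          (add_nonneg (mul_nonneg (hp i) (hq j)) (mul_nonneg (hq i) (hp j)))
        refine (add_le_add g1 g2).trans_eq ?_
        -- Equal-sign and opposite-sign coefficients add up to (u_i⁺ + u_i⁻)(u_j⁺ + u_j⁻) =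
        -- |u_i||u_j|, so one common bound for both classes loses no factor.
        rw [← add_mul, ← posPart_add_negPart (u i), ← posPart_add_negPart (u j)]
        split_ifs with hij
        · subst hij
          rw [← sq_abs (u i), ← posPart_add_negPart (u i)]
          ring
        · ring
    _ = (b + t) * ∑ i, ∑ j, |u i| * |u j| + s * ∑ i, u i ^ 2 := by
        simp_rw [Finset.sum_add_distrib, Finset.mul_sum]
        simp
    _ ≤ _ := by
        have := mul_le_mul_of_nonneg_left (sq_sum_abs_le u) hbt
        linarith

/-- The smallest singular value of the activation matrix on the event of
`exists_concentration_event`. -/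
theorem sq_sqrt_sub_sqrt_le_sq_minSingularValue (hn : 0 < n) (hnm : n ≤ m) {ε : ℝ} (hε : 0 < ε)
    {x : Fin n → EuclideanSpace ℝ (Fin d)} (hx : ∀ i, ‖x i‖ = 1) (hl : 0 ≤ lambdaStar x)
    {t : ℝ} (ht : 0 ≤ t) {w w' : Fin m → EuclideanSpace ℝ (Fin d)}
    (hw : ∀ i j,
        |∑ r, reluDeriv ⟪w r, x i⟫ * reluDeriv ⟪w r, x j⟫ - m * mho x i j| ≤ t ∧
        ∑ r, sameSign (radius ε x) ⟪w r, x i⟫ ⟪w r, x j⟫ ≤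
          m * ∫ v, sameSign (radius ε x) ⟪v, x i⟫ ⟪v, x j⟫
            ∂stdGaussian (EuclideanSpace ℝ (Fin d)) + t ∧
        ∑ r, oppSign (radius ε x) ⟪w r, x i⟫ ⟪w r, x j⟫ ≤
          m * ∫ v, oppSign (radius ε x) ⟪v, x i⟫ ⟪v, x j⟫
            ∂stdGaussian (EuclideanSpace ℝ (Fin d)) + t)
    (hww' : ∀ r, ‖w' r - w r‖ ≤ radius ε x)
    (hDL : m * (radius ε x * √(2 / π)) + m * lambdaStar x / (2 + ε) + n * t ≤
      m * lambdaStar x - n * t) :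
    (√(m * lambdaStar x - n * t) -
      √(m * (radius ε x * √(2 / π)) + m * lambdaStar x / (2 + ε) + n * t)) ^ 2 ≤
      minSingularValue (activationMatrix x w') ^ 2 := by
  have hR : 0 ≤ radius ε x := Real.sqrt_nonneg _
  have hscale : ∀ (i j : Fin n) (I : ℝ),
      I ≤ lambdaStar x / ((2 + ε) * n) + (if i = j then radius ε x * √(2 / π) else 0) →
      m * I + t ≤ (m * (lambdaStar x / ((2 + ε) * n)) +
        if i = j then m * (radius ε x * √(2 / π)) else 0) + t := by
    intro i j I hI
    have := mul_le_mul_of_nonneg_left hI (Nat.cast_nonneg (α := ℝ) m)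
    split_ifs with h <;> simp only [h, if_true, if_false] at this <;> linarith
  refine le_sq_minSingularValue hn _ hnm fun u => ?_
  have hD := sum_sq_le_of_pair_counts_le (t := t) hx hww'
    (fun i j => (hw i j).2.1.trans (hscale i j _ (by
      obtain ⟨h1, h2⟩ := integral_mul_sin_le_of_section (measurable_sameSign (radius ε x))
        (sameSign_eq_zero_or_one _) hR _ sameSign_section (hx i) (hx j)
      exact le_add_ite_of_mul_sin_le hε x hl i j h1 h2)))
    (fun i j => (hw i j).2.2.trans (hscale i j _ (by
      obtain ⟨h1, h2⟩ := integral_mul_sin_le_of_section (measurable_oppSign (radius ε x))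
        (oppSign_eq_zero_or_one _) hR _ oppSign_section (hx i) (hx j)
      exact le_add_ite_of_mul_sin_le hε x hl i j h1 h2)))
    (by positivity) u
  have hL := le_sum_sq_of_abs_sub_mho_le ht (fun i j => (hw i j).1) u
  have hn' : (n : ℝ) ≠ 0 := by positivity
  have hnb : (n : ℝ) * (m * (lambdaStar x / ((2 + ε) * n))) = m * lambdaStar x / (2 + ε) := by
    field_simp
  rw [hnb] at hD
  refine (mul_sum_sq_le_sum_add_sq (Finset.sum_nonneg fun i _ => sq_nonneg (u i)) (by positivity)
    hDL _ _ hL hD).trans_eq ?_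
  refine Finset.sum_congr rfl fun r _ => ?_
  rw [← Finset.sum_add_distrib]
  congr 1
  refine Finset.sum_congr rfl fun i _ => ?_
  rw [activationMatrix, Matrix.of_apply]
  ring

/-! ### Asymptotics and choice of constants -/

/-- There is room between `1 - √(1 / (2 + ε))` and `1 - √(2 / (2 + ε))`. -/
theorem exists_gap {ε : ℝ} (hε : 0 < ε) :
    ∃ ρ η : ℝ, 0 < ρ ∧ 0 < η ∧ 0 ≤ √(1 - ρ) - √(1 / (2 + ε) + 2 * ρ) ∧
      (1 - √(2 / (2 + ε))) ^ 2 + η ≤ (√(1 - ρ) - √(1 / (2 + ε) + 2 * ρ)) ^ 2 := by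
  set a := √(2 / (2 + ε)) with ha
  have ha1 : a < 1 := by
    rw [ha, Real.sqrt_lt' one_pos, div_lt_iff₀ (by linarith)]; linarith
  have hlt : √(1 / (2 + ε)) < a :=
    Real.sqrt_lt_sqrt (by positivity) (div_lt_div_of_pos_right (by norm_num) (by linarith))
  set g : ℝ → ℝ := fun ρ => √(1 - ρ) - √(1 / (2 + ε) + 2 * ρ) with hg
  have hcont : Continuous g := by fun_prop
  have h0 : g 0 = 1 - √(1 / (2 + ε)) := by simp [hg]
  -- The midpoint stays below g near 0 by continuity and still exceeds 1 - a > 0.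
  set μ := (g 0 + (1 - a)) / 2 with hμ
  have hμ0 : μ < g 0 := by rw [hμ, h0]; linarith
  have hμ1 : 1 - a < μ := by rw [hμ, h0]; linarith
  have hev : ∀ᶠ ρ in 𝓝[>] (0 : ℝ), μ < g ρ :=
    (hcont.tendsto 0).mono_left nhdsWithin_le_nhds |>.eventually (lt_mem_nhds hμ0)
  obtain ⟨ρ, hρ, hρ0⟩ := (hev.and self_mem_nhdsWithin).exists
  refine ⟨ρ, μ ^ 2 - (1 - a) ^ 2, hρ0, by nlinarith, by linarith, ?_⟩
  rw [add_sub_cancel]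
  exact pow_le_pow_left₀ (by linarith) hρ.le 2

theorem tendsto_mul_log_rpow_neg_atTop (s : ℝ) :
    Tendsto (fun n : ℕ => (n : ℝ) * Real.log n ^ (-s)) atTop atTop := by
  have h0 : Tendsto (fun y : ℝ => Real.log y ^ s / y ^ (1 : ℝ)) atTop (𝓝[>] 0) := by
    refine tendsto_nhdsWithin_iff.2
      ⟨(isLittleO_log_rpow_rpow_atTop s one_pos).tendsto_div_nhds_zero, ?_⟩
    filter_upwards [eventually_gt_atTop 1] with y hy
    have := Real.log_pos hy
    exact Set.mem_Ioi.2 (by positivity)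
  have h1 : Tendsto (fun y : ℝ => y * Real.log y ^ (-s)) atTop atTop := by
    refine (tendsto_inv_nhdsGT_zero.comp h0).congr' ?_
    filter_upwards [eventually_gt_atTop 1] with y hy
    rw [Function.comp_apply, inv_div, Real.rpow_one, Real.rpow_neg (Real.log_pos hy).le,
      div_eq_mul_inv]
  exact h1.comp tendsto_natCast_atTop_atTop

theorem tendsto_log_rpow_atTop {s : ℝ} (hs : 0 < s) :
    Tendsto (fun n : ℕ => Real.log n ^ s) atTop atTop :=
  (tendsto_rpow_atTop hs).comp (Real.tendsto_log_atTop.comp tendsto_natCast_atTop_atTop)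

/-- The probability bound `R √(2 / π)` of a strip is of lower order than `λ*`. -/
theorem radius_mul_sqrt_le {d n : ℕ} (hn : 0 < n) {ε q : ℝ} (hε : 0 < ε) (hq : 0 ≤ q)
    {x : Fin n → EuclideanSpace ℝ (Fin d)} (hl : 0 ≤ lambdaStar x)
    (h : 1 ≤ q ^ 2 * (n * lambdaStar x)) :
    √(lambdaStar x * Real.sin (thetaStar x) / n) ≤ q * lambdaStar x ∧
    radius ε x * √(2 / π) ≤ q * lambdaStar x := by
  have hn' : (0 : ℝ) < n := by positivity
  have h1 : √(lambdaStar x / n) ≤ q * lambdaStar x := by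
    refine Real.sqrt_le_iff.2 ⟨by positivity, ?_⟩
    rw [div_le_iff₀ hn']
    nlinarith [mul_le_mul_of_nonneg_left h hl]
  refine ⟨(Real.sqrt_le_sqrt ?_).trans h1, ?_⟩
  · gcongr
    exact mul_le_of_le_one_right hl (Real.sin_le_one _)
  · rw [radius, ← Real.sqrt_mul' _ (by positivity)]
    refine (Real.sqrt_le_sqrt ?_).trans h1
    have e : π * lambdaStar x * Real.sin (thetaStar x) / ((2 + ε) * n) * (2 / π) =
        lambdaStar x / n * (Real.sin (thetaStar x) * (2 / (2 + ε))) := by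
      have := Real.pi_ne_zero
      field_simp
    rw [e]
    refine mul_le_of_le_one_right (by positivity) ?_
    have h2 : 2 / (2 + ε) ≤ 1 := by rw [div_le_one (by linarith)]; linarith
    have h3 : 0 < 2 / (2 + ε) := by positivity
    nlinarith [Real.sin_le_one (thetaStar x)]

/-- The width assumption makes the concentration error negligible with respect to `λ* m`. -/
theorem concentration_error_le {n m : ℕ} {ℏ ϖ c₁ κ ρ l δ : ℝ} (hn : 3 ≤ n) (hδ : 0 < δ)
    (hδ1 : δ < 1) (hϖ : 0 < ϖ) (hc₁ : 0 < c₁) (hκ : 0 < κ) (hρ : 0 < ρ)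
    (hl : κ * Real.log n ^ (-(2 * ℏ)) ≤ l)
    (hlarge : 2 ≤ ρ ^ 2 * c₁ * κ ^ 2 * Real.log n ^ (ϖ - 4 * ℏ))
    (hm : c₁ * ((n : ℝ) ^ 2 * Real.log (n / δ) ^ (1 + ϖ)) ≤ m) :
    n * √(m * Real.log (2 * n / δ)) ≤ ρ * (m * l) := by
  have hn' : (3 : ℝ) ≤ n := by exact_mod_cast hn
  have hL : 0 < Real.log n := Real.log_pos (by linarith)
  have hnδ : (n : ℝ) ≤ n / δ := by rw [le_div_iff₀ hδ]; nlinarith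
  have hℓ : Real.log n ≤ Real.log (n / δ) := Real.log_le_log (by linarith) hnδ
  set ℓ := Real.log (n / δ) with hℓd
  have hℓ0 : 0 < ℓ := hL.trans_le hℓ
  -- log 2 is absorbed into log(n/δ) since n ≥ 2.
  have h2ℓ : Real.log (2 * n / δ) ≤ 2 * ℓ := by
    rw [mul_div_assoc, Real.log_mul (by norm_num) (by positivity), two_mul]
    gcongr
    exact Real.log_le_log (by norm_num) (by linarith)
  have hl0 : 0 < l := lt_of_lt_of_le (by positivity) hl
  have hl2 : κ ^ 2 * Real.log n ^ (-(4 * ℏ)) ≤ l ^ 2 := by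
    calc κ ^ 2 * Real.log n ^ (-(4 * ℏ)) = (κ * Real.log n ^ (-(2 * ℏ))) ^ 2 := by
          rw [mul_pow, ← Real.rpow_mul_natCast hL.le]
          congr 2; push_cast; ring
      _ ≤ l ^ 2 := pow_le_pow_left₀ (by positivity) hl 2
  have key : (n : ℝ) ^ 2 * Real.log (2 * n / δ) ≤ ρ ^ 2 * m * l ^ 2 := by
    -- Of the width factor ℓ^(1+ϖ), one power of ℓ pays for the logarithm in t; the rest, at least
    -- (log n)^ϖ, beats the loss (log n)^(4ℏ) from l².
    calc (n : ℝ) ^ 2 * Real.log (2 * n / δ) ≤ (n : ℝ) ^ 2 * (2 * ℓ) := by gcongr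
      _ ≤ (n : ℝ) ^ 2 * (ρ ^ 2 * c₁ * κ ^ 2 * Real.log n ^ (ϖ - 4 * ℏ) * ℓ) := by gcongr
      _ = ρ ^ 2 * (c₁ * ((n : ℝ) ^ 2 * (ℓ * Real.log n ^ ϖ))) *
          (κ ^ 2 * Real.log n ^ (-(4 * ℏ))) := by
          rw [sub_eq_add_neg, Real.rpow_add hL]; ring
      _ ≤ ρ ^ 2 * (c₁ * ((n : ℝ) ^ 2 * (ℓ * ℓ ^ ϖ))) *
          (κ ^ 2 * Real.log n ^ (-(4 * ℏ))) := by gcongr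
      _ = ρ ^ 2 * (c₁ * ((n : ℝ) ^ 2 * ℓ ^ (1 + ϖ))) *
          (κ ^ 2 * Real.log n ^ (-(4 * ℏ))) := by
          rw [Real.rpow_add hℓ0, Real.rpow_one]
      _ ≤ ρ ^ 2 * m * l ^ 2 := by gcongr
  rw [← le_div_iff₀' (by positivity)]
  refine Real.sqrt_le_iff.2 ⟨by positivity, ?_⟩
  rw [div_pow, le_div_iff₀ (by positivity)]
  have := mul_le_mul_of_nonneg_left key (Nat.cast_nonneg (α := ℝ) m)
  linarith

/-- The union bound over 4n² Hoeffding events, each failing with probability at most (δ/(2n))²,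
totals δ². -/
theorem four_mul_sq_mul_exp_eq {n m : ℕ} {δ : ℝ} (hn : 0 < n) (hm : 0 < m) (hδ : 0 < δ)
    (hlog : 0 ≤ Real.log (2 * n / δ)) :
    4 * (n : ℝ) ^ 2 * Real.exp (-2 * √(m * Real.log (2 * n / δ)) ^ 2 / m) = δ * δ := by
  rw [Real.sq_sqrt (by positivity)]
  have e : -2 * (m * Real.log (2 * n / δ)) / m = Real.log ((δ / (2 * n)) ^ 2) := by
    rw [Real.log_pow, ← inv_div (2 * (n : ℝ)) δ, Real.log_inv]
    field_simp
    push_cast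
    ring
  rw [e, Real.exp_log (by positivity)]
  field_simp
  ring

end TwoLayerReLU

/-! ### The main theorem -/

open TwoLayerReLU in
theorem mainTheorem5 :
    -- the constant of the `𝒪` term is universal
    ∃ C : ℝ, 0 < C ∧
    ∀ ε ℏ ϖ c₀ c₁ : ℝ, 0 < ε → 0 < ℏ → 4 * ℏ < ϖ → 0 < c₀ → 0 < c₁ →
    -- the `o(1)` terms depend on `n` and on `ε, ℏ, ϖ, c₀, c₁` only
    ∃ o₁ o₂ : ℕ → ℝ, Tendsto o₁ atTop (𝓝 0) ∧ Tendsto o₂ atTop (𝓝 0) ∧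
    ∀ᶠ n : ℕ in atTop,
    ∀ (d m : ℕ) (x : Fin n → EuclideanSpace ℝ (Fin d)) (δ : ℝ),
      n ≤ m → (∀ i, ‖x i‖ = 1) → 0 < δ → δ < 1 →
      c₀ * Real.log n ^ (-(2 * ℏ)) ≤ TwoLayerReLU.minEigenvalue (Matrix.gram ℝ x) →
      c₁ * ((n : ℝ) ^ 2 * Real.log (n / δ) ^ (1 + ϖ)) ≤ m →
      ∃ E : Set (Fin m → EuclideanSpace ℝ (Fin d)), MeasurableSet E ∧
        1 - ((m : ℝ) * n - m + 4 * n) * δ < (TwoLayerReLU.initLaw d m).real E ∧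
        -- on this event, the bounds hold for every evolution of the weights, in particular
        -- for the iterates of gradient descent
        ∀ w : ℕ → Fin m → EuclideanSpace ℝ (Fin d), w 0 ∈ E →
        ∀ k : ℕ, 1 ≤ k → (∀ r, ‖w k r - w 0 r‖ ≤ TwoLayerReLU.radius ε x) →
          (1 - √(2 / (2 + ε))) ^ 2 * TwoLayerReLU.lambdaStar x * m
              + (√(π / (2 + ε)) - √(1 / (2 * π)) + o₁ n) * m
                * √(TwoLayerReLU.lambdaStar x * Real.sin (TwoLayerReLU.thetaStar x) / n)
              - C * (n * √(m * Real.log (2 * n / δ)) + n * Real.log (2 * n / δ) / √δ)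
            < TwoLayerReLU.minSingularValue (TwoLayerReLU.activationMatrix x (w k)) ^ 2 ∧
          ((1 - √(2 / (2 + ε))) ^ 2 + o₂ n) * TwoLayerReLU.lambdaStar x * m
            ≤ TwoLayerReLU.minSingularValue (TwoLayerReLU.activationMatrix x (w k)) ^ 2 := by
  refine ⟨1, one_pos, fun ε ℏ ϖ c₀ c₁ hε hℏ hϖ hc₀ hc₁ => ⟨fun _ => 0, fun _ => 0,
    tendsto_const_nhds, tendsto_const_nhds, ?_⟩⟩
  obtain ⟨ρ, η, hρ, hη, hgap0, hgap⟩ := exists_gap hε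
  set A := √(π / (2 + ε)) - √(1 / (2 * π)) with hA
  -- Two demands on q: the diagonal strip term must stay below ρλ*m, and the A-term of the first
  -- bound below ηλ*m. The added 1 avoids division by zero.
  set q := min ρ (η / (|A| + 1)) with hq
  have hq0 : 0 < q := lt_min hρ (by positivity)
  set κ := meanPosPart ^ 2 * c₀ with hκ
  have hκ0 : 0 < κ := mul_pos (pow_pos meanPosPart_pos 2) hc₀
  filter_upwards [eventually_ge_atTop 3,
    (tendsto_mul_log_rpow_neg_atTop (2 * ℏ)).eventually_ge_atTop (1 / (q ^ 2 * κ)),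
    (tendsto_log_rpow_atTop (sub_pos.2 hϖ)).eventually_ge_atTop (2 / (ρ ^ 2 * c₁ * κ ^ 2))]
    with n hn3 hnl hlog d m x δ hnm hx hδ hδ1 hgram hm
  have hn : 0 < n := by omega
  have hm0 : (0 : ℝ) < m := by exact_mod_cast hn.trans_le hnm
  have hn3' : (3 : ℝ) ≤ n := by exact_mod_cast hn3
  have hnm' : (n : ℝ) ≤ m := by exact_mod_cast hnm
  have hlκ : κ * Real.log n ^ (-(2 * ℏ)) ≤ lambdaStar x := by
    refine le_trans ?_ (meanPosPart_sq_mul_minEigenvalue_gram_le_lambdaStar hn hx)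
    rw [hκ, mul_assoc]
    gcongr
  set l := lambdaStar x with hl
  have hl0 : 0 < l := by
    have : 0 < Real.log n := Real.log_pos (by linarith)
    exact lt_of_lt_of_le (by positivity) hlκ
  have hlog2 : 0 < Real.log (2 * n / δ) :=
    Real.log_pos (by rw [lt_div_iff₀ hδ]; nlinarith)
  set t := √(m * Real.log (2 * n / δ)) with ht
  have ht0 : 0 ≤ t := Real.sqrt_nonneg _
  have hnt : n * t ≤ ρ * (m * l) := by
    refine concentration_error_le hn3 hδ hδ1 (by linarith) hc₁ hκ0 hρ hlκ ?_ hm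
    rwa [div_le_iff₀' (by positivity)] at hlog
  have hql : 1 ≤ q ^ 2 * (n * l) := by
    rw [div_le_iff₀' (by positivity)] at hnl
    calc 1 ≤ q ^ 2 * κ * (n * Real.log n ^ (-(2 * ℏ))) := hnl
      _ = q ^ 2 * (n * (κ * Real.log n ^ (-(2 * ℏ)))) := by ring
      _ ≤ _ := by gcongr
  obtain ⟨hsin, hrad⟩ := radius_mul_sqrt_le hn hε hq0.le hl0.le hql
  obtain ⟨E, hE, hPE, hEw⟩ := exists_concentration_event (m := m) x (radius ε x) ht0
  refine ⟨E, hE, lt_of_lt_of_le ?_ hPE, fun w hw k _ hk => ?_⟩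
  -- The failure probability δ² is below δ, and the coefficient m(n - 1) + 4n is at least 1.
  · rw [four_mul_sq_mul_exp_eq hn (hn.trans_le hnm) hδ hlog2.le]
    have h1 : 0 ≤ (m : ℝ) * (n - 1) := mul_nonneg hm0.le (by linarith)
    have h2 : 1 * δ ≤ ((m : ℝ) * n - m + 4 * n) * δ :=
      mul_le_mul_of_nonneg_right (by linarith) hδ.le
    have h3 : δ * δ < 1 * δ := mul_lt_mul_of_pos_right hδ1 hδ
    linarith
  have hml : 0 < m * l := by positivity
  have hD : m * (radius ε x * √(2 / π)) + m * l / (2 + ε) + n * t ≤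
      m * l * (1 / (2 + ε) + 2 * ρ) := by
    have h1 : m * (radius ε x * √(2 / π)) ≤ m * (ρ * l) := by
      refine mul_le_mul_of_nonneg_left (hrad.trans ?_) hm0.le
      exact mul_le_mul_of_nonneg_right (min_le_left _ _) hl0.le
    have h2 : m * l * (1 / (2 + ε) + 2 * ρ) = m * l / (2 + ε) + 2 * (ρ * (m * l)) := by ring
    linarith
  have hL : m * l * (1 - ρ) ≤ m * l - n * t := by linarith
  -- Recovered from the ordering of the square roots: the left side is positive, so truncation of
  -- the root at negative arguments causes no loss.
  have hρ2 : 1 / (2 + ε) + 2 * ρ ≤ 1 - ρ := by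
    by_contra! h
    have := Real.sqrt_lt_sqrt_iff_of_pos (x := 1 - ρ) (y := 1 / (2 + ε) + 2 * ρ) (by positivity)
    have := this.2 h
    linarith
  have hmain : ((1 - √(2 / (2 + ε))) ^ 2 + η) * (m * l) ≤
      minSingularValue (activationMatrix x (w k)) ^ 2 := by
    refine le_trans ?_ (sq_sqrt_sub_sqrt_le_sq_minSingularValue hn hnm hε hx hl0.le ht0
      (hEw (w 0) hw) hk (hD.trans (le_trans (by gcongr) hL)))
    calc ((1 - √(2 / (2 + ε))) ^ 2 + η) * (m * l)
        ≤ (√(1 - ρ) - √(1 / (2 + ε) + 2 * ρ)) ^ 2 * (m * l) := by gcongr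
      _ = (√(m * l * (1 - ρ)) - √(m * l * (1 / (2 + ε) + 2 * ρ))) ^ 2 := by
          rw [Real.sqrt_mul hml.le, Real.sqrt_mul hml.le, ← mul_sub, mul_pow, Real.sq_sqrt hml.le]
          ring
      _ ≤ _ := by
          refine pow_le_pow_left₀ ?_ (sub_le_sub (Real.sqrt_le_sqrt hL) (Real.sqrt_le_sqrt hD)) 2
          exact sub_nonneg.2 (Real.sqrt_le_sqrt (by gcongr))
  refine ⟨lt_of_lt_of_le ?_ hmain, le_trans ?_ hmain⟩
  · have h1 : A * m * √(l * Real.sin (thetaStar x) / n) ≤ η * (m * l) := by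
      calc A * m * √(l * Real.sin (thetaStar x) / n)
          ≤ (|A| + 1) * m * (q * l) := by
            refine mul_le_mul ?_ hsin (Real.sqrt_nonneg _) (by positivity)
            exact mul_le_mul_of_nonneg_right (by linarith [le_abs_self A]) hm0.le
        _ ≤ (|A| + 1) * m * (η / (|A| + 1) * l) := by
            refine mul_le_mul_of_nonneg_left ?_ (by positivity)
            exact mul_le_mul_of_nonneg_right (min_le_right _ _) hl0.le
        _ = η * (m * l) := by
            have : |A| + 1 ≠ 0 := by positivity
            field_simp
    -- The subtracted 𝒪 term is needed only for strictness, so any positive constant, here 1, will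
    -- do.
    have h2 : 0 < (n : ℝ) * t + n * Real.log (2 * n / δ) / √δ := by positivity
    rw [add_zero]
    linarith
  · rw [add_zero]
    have := mul_pos hη hml
    linarith
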